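/- Write $\mathcal P_2(X)$ for the Borel probability measures on $\mathbb R^d$ that are carried by $X\subseteq\mathbb R^d$ and have finite second moment, and $\mathcal P_2^a(X)$ for those that are absolutely continuous with respect to Lebesgue measure. An optimal transport map from $v$ to $\mu$ is a measurable map $\mathbf t:\mathbb R^d\to\mathbb R^d$ with $\mathbf t_\#v=\mu$ and $\int|\mathbf t(x)-x|^2\,dv(x)=d_W^2(v,\mu)$, where $d_W^2(v,\mu)$ is the infimum of $\int|x-y|^2\,d\gamma(x,y)$ over all plans $\gamma$ with marginals $v$ and $\mu$; for absolutely continuous $v$ it is $v$-a.e. unique and is denoted $\mathbf t_v^\mu$. The pseudo-Wasserstein distance with base $v$ is $d_v(\mu_1,\mu_2)=\left(\int|\mathbf t_v^{\mu_1}-\mathbf t_v^{\mu_2}|^2\,dv\right)^{1/2}$. Lemma 4.5. For all real $D,V$ there are constants $C>0$ and $s_0>0$, depending only on $D$ and $V$, such that the following holds. Let $d\ge 1$, let $\Omega\subset\mathbb R^d$ be bounded and convex with diameter $D$ and volume $V$, and let $\mu\in\mathcal P_2(\overline\Omega)$ and $v\in\mathcal P_2^a(\Omega)$. Let $e$ be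 the uniform probability measure on $\Omega$. Then for every $0<s<s_0$ there is $\mu_s\in\mathcal P_2^a(\Omega)$ such that the optimal transport maps $\mathbf t_v^{\mu},\mathbf t_v^{\mu_s},\mathbf t_v^{e}$ exist and $$d_v(\mu,\mu_s)\le C s,\qquad \frac{d\mu_s}{d\mathcal L^d}(x)\le s^{-d}\ \text{ for a.e. } x.$$ Moreover, $\mu_s$ can be taken on the generalized geodesic with base $v$ from $\mu$ to $e$: $\mu_s=\big((1-\tau)\mathbf t_v^{\mu}+\tau\,\mathbf t_v^{e}\big)_\#v$ with $\tau=s/V^{1/d}\le 1$ (so $\tau=s$ if $V=1$). -/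

import Mathlib

open MeasureTheory
open scoped ENNReal

namespace Transport

/-- Euclidean space of dimension `d` (with its Euclidean norm and Lebesgue measure `volume`). -/
abbrev E (d : ℕ) : Type := EuclideanSpace ℝ (Fin d)

/-- Borel probability measures on `X` with finite second moment, seen as measures on the whole
space that give no mass to the complement of `X`. -/
structure IsP2 {d : ℕ} (X : Set (E d)) (μ : Measure (E d)) : Prop where
  prob : IsProbabilityMeasure μ
  carried : μ Xᶜ = 0
  secondMoment : ∫⁻ x, ‖x‖ₑ ^ 2 ∂μ < ∞

/-- Members of the above class that are absolutely continuous w.r.t. Lebesgue measure. -/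
structure IsP2a {d : ℕ} (X : Set (E d)) (μ : Measure (E d)) : Prop extends IsP2 X μ where
  absCont : μ ≪ volume

/-- `γ` is a transport plan between `μ₁` and `μ₂`. -/
structure IsPlan {d : ℕ} (μ₁ μ₂ : Measure (E d)) (γ : Measure (E d × E d)) : Prop where
  map_fst : γ.map Prod.fst = μ₁
  map_snd : γ.map Prod.snd = μ₂

/-- The square of the 2-Wasserstein distance: the least quadratic cost of a transport plan. -/
noncomputable def wassersteinSq {d : ℕ} (μ₁ μ₂ : Measure (E d)) : ℝ≥0∞ :=
  ⨅ (γ : Measure (E d × E d)) (_ : IsPlan μ₁ μ₂ γ), ∫⁻ p, ‖p.1 - p.2‖ₑ ^ 2 ∂γ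

/-- `T` is an optimal transport map from `v` to `μ`: a measurable map pushing `v` forward to `μ`
whose quadratic cost is the squared 2-Wasserstein distance. -/
structure IsOptimalMap {d : ℕ} (v μ : Measure (E d)) (T : E d → E d) : Prop where
  measurable : Measurable T
  map_eq : v.map T = μ
  cost_eq : ∫⁻ x, ‖T x - x‖ₑ ^ 2 ∂v = wassersteinSq v μ

/-- A choice of optimal transport map from `v` to `μ` (meaningful when one exists). -/
noncomputable def optimalMap {d : ℕ} (v μ : Measure (E d)) : E d → E d :=
  Classical.epsilon (IsOptimalMap v μ)

/-- The pseudo-Wasserstein distance with base `v` between `μ₁` and `μ₂`: the distance in `L²(v)`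
of the optimal transport maps from `v` to `μ₁` and to `μ₂`. -/
noncomputable def pseudoWasserstein {d : ℕ} (v μ₁ μ₂ : Measure (E d)) : ℝ≥0∞ :=
  (∫⁻ x, ‖optimalMap v μ₁ x - optimalMap v μ₂ x‖ₑ ^ 2 ∂v) ^ ((1 : ℝ) / 2)

/-- The point at time `τ` of the generalized geodesic with base `v` from `μ₁` to `μ₂`. -/
noncomputable def generalizedGeodesic {d : ℕ} (v μ₁ μ₂ : Measure (E d)) (τ : ℝ) :
    Measure (E d) :=
  v.map (fun x => (1 - τ) • optimalMap v μ₁ x + τ • optimalMap v μ₂ x)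

/-- The uniform probability measure on `Ω`. -/
noncomputable def uniform {d : ℕ} (Ω : Set (E d)) : Measure (E d) :=
  (volume Ω)⁻¹ • volume.restrict Ω

end Transport

/-! Write `t`, `G` for the optimal maps from `v` to `μ` and to the uniform measure, and `H = (1 - τ)
t + τ G`. Both are gradients of convex functions, hence so is `H`; it is therefore the optimal map
to its image `μs`, and `t - H = τ (t - G)` has norm at most `τ · diam Ω`. Since `t` is monotone, `H`
spreads mass at least as much as `τ G`, whose image of `v` has density at most `1 / (V τ^d)`. The
choice `τ = s / V^(1/d)` turns this into `s^(-d)`.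

The density bound is obtained without Jacobians (`map_combo_gradient_le`). Replace `t` by gradients
of finite maxima of affine functions: monotone maps with finitely many values, converging to `t`
almost everywhere. On each piece of constancy `H` is a translate of `τ G`, so volumes scale exactly
by `τ^d`; strict monotonicity of `G` off a null set makes `H` injective, so the images of the pieces
are disjoint and the bounds add up. The bound survives the limit by Fatou on open sets and outer
regularity.

Existence of the maps (`exists_gradient_map_eq`) comes from the dual Kantorovich problem on a ball:
a minimizer exists by Arzelà–Ascoli, and its first variation says that the gradient of the conjugate
pushes `v` to `μ`. Optimality and uniqueness are the equality case of Fenchel's inequality together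
with Rademacher's theorem. -/

namespace Transport
open Metric Filter Topology Set

/-- The Legendre transform of `f` restricted to the closed ball of radius `R`. -/
noncomputable def ballConj {d : ℕ} (R : ℝ) (f : E d → ℝ) (y : E d) : ℝ :=
  sSup ((fun x => inner ℝ x y - f x) '' closedBall 0 R)

/-! ### Legendre transforms over a ball and their gradients -/

section ballConj

variable {d : ℕ} {R : ℝ} {f : E d → ℝ}

theorem le_ballConj (hf : Continuous f) {x : E d} (hx : x ∈ closedBall (0 : E d) R) (y : E d) :
    inner ℝ x y - f x ≤ ballConj R f y :=
  le_csSup ((isCompact_closedBall 0 R).bddAbove_image (by fun_prop)) (mem_image_of_mem _ hx)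

theorem exists_ballConj_eq (hR : 0 ≤ R) (hf : Continuous f) (y : E d) :
    ∃ x ∈ closedBall (0 : E d) R, ballConj R f y = inner ℝ x y - f x := by
  obtain ⟨x, hx, h⟩ := (isCompact_closedBall (0 : E d) R).exists_sSup_image_eq
    ⟨0, mem_closedBall_self hR⟩ (f := fun x => inner ℝ x y - f x) (by fun_prop)
  exact ⟨x, hx, h⟩

/-- A supremum of `R`-Lipschitz affine functions. By Rademacher's theorem it is differentiable
almost everywhere, however rough the continuous function `f` is. -/
theorem ballConj_lipschitz (hR : 0 ≤ R) (hf : Continuous f) :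
    LipschitzWith R.toNNReal (ballConj R f) := by
  refine LipschitzWith.of_le_add_mul _ fun y z => ?_
  obtain ⟨x, hx, h⟩ := exists_ballConj_eq hR hf y
  have h1 := le_ballConj hf hx z
  have h2 : inner ℝ x y - inner ℝ x z ≤ R * dist y z := by
    rw [← inner_sub_right, dist_eq_norm]
    exact (real_inner_le_norm _ _).trans
      (mul_le_mul_of_nonneg_right (mem_closedBall_zero_iff.1 hx) (norm_nonneg _))
  rw [Real.coe_toNNReal _ hR]
  linarith

theorem ballConj_continuous (hR : 0 ≤ R) (hf : Continuous f) : Continuous (ballConj R f) :=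
  (ballConj_lipschitz hR hf).continuous

/-- The equality case of Fenchel's inequality gives a subgradient. -/
theorem ballConj_subgradient (hf : Continuous f) {x y : E d} (hx : x ∈ closedBall (0 : E d) R)
    (h : ballConj R f y = inner ℝ x y - f x) (z : E d) :
    ballConj R f y + inner ℝ x (z - y) ≤ ballConj R f z := by
  have := le_ballConj hf hx z
  rw [inner_sub_right]
  linarith

/-- Subtracting the supporting affine function leaves a local minimum at `x`, where the derivative
vanishes; convexity is not needed. -/
theorem eq_gradient_of_subgradient {Φ : E d → ℝ} {x y : E d} {s : Set (E d)} (hs : s ∈ 𝓝 x)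
    (hd : DifferentiableAt ℝ Φ x) (h : ∀ z ∈ s, Φ x + inner ℝ y (z - x) ≤ Φ z) :
    y = gradient Φ x := by
  have hmin : IsLocalMin (fun z => Φ z - inner ℝ y z) x := by
    filter_upwards [hs] with z hz
    have := h z hz
    rw [inner_sub_right] at this
    linarith
  have hg : HasGradientAt Φ (gradient Φ x) x := hd.hasGradientAt
  generalize gradient Φ x = G at hg ⊢
  have h1 : HasFDerivAt (fun z => Φ z - inner ℝ y z)
      (InnerProductSpace.toDual ℝ (E d) G - innerSL ℝ y) x :=
    hg.hasFDerivAt.sub (innerSL ℝ y).hasFDerivAt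
  have h2 := hmin.hasFDerivAt_eq_zero h1
  refine (ext_inner_right ℝ fun w => ?_)
  have := congrArg (fun L => L w) h2
  simp at this
  linarith

theorem eq_gradient_ballConj (hf : Continuous f) {x y : E d} (hx : x ∈ closedBall (0 : E d) R)
    (hd : DifferentiableAt ℝ (ballConj R f) y) (h : ballConj R f y = inner ℝ x y - f x) :
    x = gradient (ballConj R f) y :=
  eq_gradient_of_subgradient univ_mem hd fun z _ => ballConj_subgradient hf hx h z

theorem gradient_ballConj_mem (hR : 0 ≤ R) (hf : Continuous f) {y : E d}
    (hd : DifferentiableAt ℝ (ballConj R f) y) :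
    gradient (ballConj R f) y ∈ closedBall (0 : E d) R := by
  obtain ⟨x, hx, h⟩ := exists_ballConj_eq hR hf y
  exact eq_gradient_ballConj hf hx hd h ▸ hx

theorem ballConj_eq_gradient (hR : 0 ≤ R) (hf : Continuous f) {y : E d}
    (hd : DifferentiableAt ℝ (ballConj R f) y) :
    ballConj R f y = inner ℝ (gradient (ballConj R f) y) y - f (gradient (ballConj R f) y) := by
  obtain ⟨x, hx, h⟩ := exists_ballConj_eq hR hf y
  exact eq_gradient_ballConj hf hx hd h ▸ h

theorem ae_differentiableAt_ballConj (hR : 0 ≤ R) (hf : Continuous f) {v : Measure (E d)}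
    (hv : v ≪ volume) : ∀ᵐ y ∂v, DifferentiableAt ℝ (ballConj R f) y :=
  hv.ae_le (ballConj_lipschitz hR hf).ae_differentiableAt

theorem measurable_gradient (Φ : E d → ℝ) : Measurable (gradient Φ) :=
  (InnerProductSpace.toDual ℝ (E d)).symm.continuous.measurable.comp (measurable_fderiv ℝ Φ)

/-- Approximate maximizers converge to the maximizer where it is unique. -/
theorem tendsto_gradient_ballConj (hf : Continuous f) {y : E d}
    (hd : DifferentiableAt ℝ (ballConj R f) y) {u : ℕ → E d}
    (hu : ∀ n, u n ∈ closedBall (0 : E d) R)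
    (hlim : Tendsto (fun n => inner ℝ (u n) y - f (u n)) atTop (𝓝 (ballConj R f y))) :
    Tendsto u atTop (𝓝 (gradient (ballConj R f) y)) := by
  -- Every cluster point attains the supremum, and differentiability at `y` leaves only one
  -- maximizer.
  refine (isCompact_closedBall (0 : E d) R).tendsto_nhds_of_unique_mapClusterPt
    (Eventually.of_forall hu) fun x hx hc => ?_
  refine eq_gradient_ballConj hf hx hd ?_
  have h1 : MapClusterPt (inner ℝ x y - f x) atTop (fun n => inner ℝ (u n) y - f (u n)) :=
    hc.continuousAt_comp (f := fun x => inner ℝ x y - f x) (by fun_prop)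
  exact (eq_of_nhds_neBot (h1.neBot.mono (inf_le_inf_left _ hlim))).symm

end ballConj
theorem _root_.Continuous.integrable_of_ae_mem_isCompact {X : Type*} [TopologicalSpace X]
    [MeasurableSpace X] [BorelSpace X] [T2Space X] {f : X → ℝ} (hf : Continuous f) {K : Set X}
    (hK : IsCompact K) {v : Measure X} [IsFiniteMeasure v] (hv : ∀ᵐ x ∂v, x ∈ K) :
    Integrable f v := by
  have := hf.continuousOn.integrableOn_compact (μ := v) hK
  rwa [IntegrableOn, Measure.restrict_eq_self_of_ae_mem hv] at this

/-! ### Optimality and uniqueness of maps into a subdifferential -/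

section Subgradient

variable {d : ℕ} {R : ℝ} {Φ : E d → ℝ} {v : Measure (E d)}

theorem enorm_sub_sq (x y : E d) : ‖x - y‖ₑ ^ 2 = ENNReal.ofReal (‖x - y‖ ^ 2) := by
  rw [ENNReal.ofReal_pow (norm_nonneg _), ofReal_norm]

/-- Fenchel's inequality after completing the square: the pair of potentials is admissible for the
dual problem with quadratic cost. -/
theorem dual_le_norm_sub_sq (hΦ : Continuous Φ) {x : E d} (hx : x ∈ closedBall (0 : E d) R)
    (y : E d) : (‖x‖ ^ 2 - 2 * Φ x) + (‖y‖ ^ 2 - 2 * ballConj R Φ y) ≤ ‖y - x‖ ^ 2 := by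
  have := le_ballConj hΦ hx y
  rw [norm_sub_sq_real, real_inner_comm]
  linarith

/-- Both sides say that `x` attains the supremum defining `ballConj R Φ y`, the equality case of
Fenchel's inequality. -/
theorem subgradient_iff_dual_eq (hR : 0 ≤ R) (hΦ : Continuous Φ) {x : E d}
    (hx : x ∈ closedBall (0 : E d) R) (y : E d) :
    (∀ z ∈ closedBall (0 : E d) R, Φ x + inner ℝ y (z - x) ≤ Φ z) ↔
    (‖x‖ ^ 2 - 2 * Φ x) + (‖y‖ ^ 2 - 2 * ballConj R Φ y) = ‖y - x‖ ^ 2 := by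
  have key := le_ballConj hΦ hx y
  rw [norm_sub_sq_real, real_inner_comm x y]
  constructor
  · intro h
    obtain ⟨z, hz, hz'⟩ := exists_ballConj_eq hR hΦ y
    have := h z hz
    rw [inner_sub_right, real_inner_comm z y, real_inner_comm x y] at this
    linarith
  · intro h z hz
    have := le_ballConj hΦ hz y
    rw [inner_sub_right, real_inner_comm z y, real_inner_comm x y]
    linarith

/-- The dual value depends on `S` only through `v.map S`, so it is the same for all maps with the
same image measure. -/
theorem integral_dual_comp (hR : 0 ≤ R) (hΦ : Continuous Φ) [IsProbabilityMeasure v]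
    (hv : ∀ᵐ x ∂v, x ∈ closedBall (0 : E d) R) {S : E d → E d} (hS : Measurable S)
    (hSR : ∀ᵐ x ∂v, S x ∈ closedBall (0 : E d) R) :
    Integrable (fun x => (‖x‖ ^ 2 - 2 * Φ x) + (‖S x‖ ^ 2 - 2 * ballConj R Φ (S x))) v ∧
    Integrable (fun x => ‖S x - x‖ ^ 2) v ∧
    ∫ x, (‖x‖ ^ 2 - 2 * Φ x) + (‖S x‖ ^ 2 - 2 * ballConj R Φ (S x)) ∂v =
      ∫ x, (‖x‖ ^ 2 - 2 * Φ x) ∂v + ∫ y, (‖y‖ ^ 2 - 2 * ballConj R Φ y) ∂(v.map S) := by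
  have hc := ballConj_continuous hR hΦ
  have hp : IsProbabilityMeasure (v.map S) := Measure.isProbabilityMeasure_map hS.aemeasurable
  have hK := isCompact_closedBall (0 : E d) R
  have hm : ∀ᵐ y ∂(v.map S), y ∈ closedBall (0 : E d) R :=
    (ae_map_iff hS.aemeasurable measurableSet_closedBall).2 hSR
  have h1 : Integrable (fun x => ‖x‖ ^ 2 - 2 * Φ x) v :=
    Continuous.integrable_of_ae_mem_isCompact (by fun_prop) hK hv
  have hb : Continuous (fun y : E d => ‖y‖ ^ 2 - 2 * ballConj R Φ y) := by fun_prop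
  have h2 := hb.integrable_of_ae_mem_isCompact hK hm
  have h3 := h2.comp_measurable hS
  refine ⟨h1.add h3, ?_, ?_⟩
  · have hp2 : IsProbabilityMeasure (v.map fun x => (S x, x)) :=
      Measure.isProbabilityMeasure_map (by fun_prop)
    have : Integrable (fun p : E d × E d => ‖p.1 - p.2‖ ^ 2) (v.map fun x => (S x, x)) := by
      refine Continuous.integrable_of_ae_mem_isCompact (by fun_prop) (hK.prod hK) ?_
      refine (ae_map_iff (hS.prodMk measurable_id).aemeasurable
        (measurableSet_closedBall.prod measurableSet_closedBall)).2 ?_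
      filter_upwards [hv, hSR] with x h h' using ⟨h', h⟩
    exact this.comp_measurable (g := fun p : E d × E d => ‖p.1 - p.2‖ ^ 2) (by fun_prop)
  · rw [integral_map hS.aemeasurable hb.aestronglyMeasurable]
    exact integral_add h1 h3

/-- A map with values in the subdifferential of a continuous function is optimal. -/
theorem isOptimalMap_of_subgradient (hR : 0 ≤ R) (hΦ : Continuous Φ) [IsProbabilityMeasure v]
    (hv : ∀ᵐ x ∂v, x ∈ closedBall (0 : E d) R) {T : E d → E d} (hT : Measurable T)
    (hTR : ∀ᵐ x ∂v, T x ∈ closedBall (0 : E d) R)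
    (hsub : ∀ᵐ x ∂v, ∀ z ∈ closedBall (0 : E d) R, Φ x + inner ℝ (T x) (z - x) ≤ Φ z) :
    IsOptimalMap v (v.map T) T := by
  refine ⟨hT, rfl, le_antisymm ?_ ?_⟩
  · refine le_iInf₂ fun γ hγ => ?_
    obtain ⟨hI, -, hE⟩ := integral_dual_comp hR hΦ hv hT hTR
    have hc := ballConj_continuous hR hΦ
    have hK := isCompact_closedBall (0 : E d) R
    have hfin : IsProbabilityMeasure γ := by
      constructor
      have := congrArg (fun m => m univ) hγ.map_fst
      simpa [Measure.map_apply measurable_fst MeasurableSet.univ] using this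
    have hγ1 : ∀ᵐ p ∂γ, p.1 ∈ closedBall (0 : E d) R := by
      rw [← hγ.map_fst] at hv
      exact (ae_map_iff measurable_fst.aemeasurable measurableSet_closedBall).1 hv
    have hγ2 : ∀ᵐ p ∂γ, p.2 ∈ closedBall (0 : E d) R := by
      have : ∀ᵐ y ∂(v.map T), y ∈ closedBall (0 : E d) R :=
        (ae_map_iff hT.aemeasurable measurableSet_closedBall).2 hTR
      rw [← hγ.map_snd] at this
      exact (ae_map_iff measurable_snd.aemeasurable measurableSet_closedBall).1 this
    have hγ12 : ∀ᵐ p ∂γ, p ∈ closedBall (0 : E d) R ×ˢ closedBall (0 : E d) R := by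
      filter_upwards [hγ1, hγ2] with p h h' using ⟨h, h'⟩
    have h1 : Integrable (fun p : E d × E d => ‖p.1‖ ^ 2 - 2 * Φ p.1) γ :=
      Continuous.integrable_of_ae_mem_isCompact (by fun_prop) (hK.prod hK) hγ12
    have h2 : Integrable (fun p : E d × E d => ‖p.2‖ ^ 2 - 2 * ballConj R Φ p.2) γ :=
      Continuous.integrable_of_ae_mem_isCompact (by fun_prop) (hK.prod hK) hγ12
    have h3 : Integrable (fun p : E d × E d => ‖p.1 - p.2‖ ^ 2) γ :=
      Continuous.integrable_of_ae_mem_isCompact (by fun_prop) (hK.prod hK) hγ12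
    -- The dual value sees only the marginals, hence agrees for `γ` and for the graph of `T`; it
    -- bounds the cost of `γ` from below and equals that of `T`.
    have hEγ : ∫ p, (‖p.1‖ ^ 2 - 2 * Φ p.1) + (‖p.2‖ ^ 2 - 2 * ballConj R Φ p.2) ∂γ =
        ∫ x, (‖x‖ ^ 2 - 2 * Φ x) + (‖T x‖ ^ 2 - 2 * ballConj R Φ (T x)) ∂v := by
      rw [hE, integral_add h1 h2, ← hγ.map_snd]
      conv_rhs => rw [← hγ.map_fst]
      rw [integral_map measurable_fst.aemeasurable
          (Continuous.aestronglyMeasurable (by fun_prop)),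
        integral_map measurable_snd.aemeasurable
          (Continuous.aestronglyMeasurable (by fun_prop))]
    have hEv : ∫ x, ‖T x - x‖ ^ 2 ∂v =
        ∫ x, (‖x‖ ^ 2 - 2 * Φ x) + (‖T x‖ ^ 2 - 2 * ballConj R Φ (T x)) ∂v := by
      refine integral_congr_ae ?_
      filter_upwards [hv, hsub] with x hx h
      exact ((subgradient_iff_dual_eq hR hΦ hx _).1 h).symm
    have hTI : Integrable (fun x => ‖T x - x‖ ^ 2) v :=
      (integral_dual_comp hR hΦ hv hT hTR).2.1
    simp_rw [enorm_sub_sq]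
    rw [← ofReal_integral_eq_lintegral_ofReal hTI (Eventually.of_forall fun _ => sq_nonneg _),
      ← ofReal_integral_eq_lintegral_ofReal h3 (Eventually.of_forall fun _ => sq_nonneg _)]
    refine ENNReal.ofReal_le_ofReal ?_
    rw [hEv, ← hEγ]
    refine integral_mono_ae (h1.add h2) h3 ?_
    filter_upwards [hγ1] with p hp
    have := dual_le_norm_sub_sq hΦ hp p.2
    rwa [norm_sub_rev] at this
  · have hplan : IsPlan v (v.map T) (v.map fun x => (x, T x)) := by
      constructor
      · rw [Measure.map_map measurable_fst (by fun_prop)]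
        exact Measure.map_id
      · rw [Measure.map_map measurable_snd (by fun_prop)]
        rfl
    refine (iInf₂_le _ hplan).trans_eq ?_
    · rw [lintegral_map (by fun_prop) (by fun_prop)]
      simp_rw [enorm_sub_sq, norm_sub_rev]

/-- Every optimal map takes its values in the subdifferential of the potential of one of them. -/
theorem IsOptimalMap.subgradient (hR : 0 ≤ R) (hΦ : Continuous Φ) [IsProbabilityMeasure v]
    (hv : ∀ᵐ x ∂v, x ∈ closedBall (0 : E d) R) {T : E d → E d} (hT : Measurable T)
    (hTR : ∀ᵐ x ∂v, T x ∈ closedBall (0 : E d) R)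
    (hsub : ∀ᵐ x ∂v, ∀ z ∈ closedBall (0 : E d) R, Φ x + inner ℝ (T x) (z - x) ≤ Φ z)
    {S : E d → E d} (hS : IsOptimalMap v (v.map T) S) :
    ∀ᵐ x ∂v, ∀ z ∈ closedBall (0 : E d) R, Φ x + inner ℝ (S x) (z - x) ≤ Φ z := by
  have hSR : ∀ᵐ x ∂v, S x ∈ closedBall (0 : E d) R := by
    have : ∀ᵐ y ∂(v.map T), y ∈ closedBall (0 : E d) R :=
      (ae_map_iff hT.aemeasurable measurableSet_closedBall).2 hTR
    rw [← hS.map_eq] at this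
    exact (ae_map_iff hS.measurable.aemeasurable measurableSet_closedBall).1 this
  obtain ⟨hIT, hNT, hET⟩ := integral_dual_comp hR hΦ hv hT hTR
  obtain ⟨hIS, hNS, hES⟩ := integral_dual_comp hR hΦ hv hS.measurable hSR
  have hcost : ∫⁻ x, ‖S x - x‖ₑ ^ 2 ∂v = ∫⁻ x, ‖T x - x‖ₑ ^ 2 ∂v :=
    hS.cost_eq.trans (isOptimalMap_of_subgradient hR hΦ hv hT hTR hsub).cost_eq.symm
  simp_rw [enorm_sub_sq] at hcost
  rw [← ofReal_integral_eq_lintegral_ofReal hNT (Eventually.of_forall fun _ => sq_nonneg _),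
    ← ofReal_integral_eq_lintegral_ofReal hNS (Eventually.of_forall fun _ => sq_nonneg _),
    ENNReal.ofReal_eq_ofReal_iff (integral_nonneg fun _ => sq_nonneg _)
      (integral_nonneg fun _ => sq_nonneg _)] at hcost
  have hEv : ∫ x, ‖T x - x‖ ^ 2 ∂v =
      ∫ x, (‖x‖ ^ 2 - 2 * Φ x) + (‖T x‖ ^ 2 - 2 * ballConj R Φ (T x)) ∂v := by
    refine integral_congr_ae ?_
    filter_upwards [hv, hsub] with x hx h
    exact ((subgradient_iff_dual_eq hR hΦ hx _).1 h).symm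
  -- The duality gap of `S` is nonnegative with zero integral, so it vanishes almost everywhere.
  have hz : ∫ x, (‖S x - x‖ ^ 2 -
      ((‖x‖ ^ 2 - 2 * Φ x) + (‖S x‖ ^ 2 - 2 * ballConj R Φ (S x)))) ∂v = 0 := by
    rw [integral_sub hNS hIS, hES, hS.map_eq, ← hET, hcost, hEv, sub_self]
  have hz' := (integral_eq_zero_iff_of_nonneg_ae ?_ (hNS.sub hIS)).1 hz
  · filter_upwards [hz', hv] with x h hx
    refine (subgradient_iff_dual_eq hR hΦ hx _).2 ?_
    simp only [Pi.zero_apply, Pi.sub_apply] at h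
    linarith
  · filter_upwards [hv] with x hx
    have := dual_le_norm_sub_sq hΦ hx (S x)
    simp only [Pi.zero_apply, Pi.sub_apply]
    linarith

/-- Optimal maps are unique when the potential is differentiable almost everywhere. -/
theorem IsOptimalMap.ae_eq_of_subgradient (hR : 0 ≤ R) (hΦ : Continuous Φ)
    [IsProbabilityMeasure v] (hd : ∀ᵐ x ∂v, DifferentiableAt ℝ Φ x)
    (hv : ∀ᵐ x ∂v, x ∈ ball (0 : E d) R) {T : E d → E d} (hT : Measurable T)
    (hTR : ∀ᵐ x ∂v, T x ∈ closedBall (0 : E d) R)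
    (hsub : ∀ᵐ x ∂v, ∀ z ∈ closedBall (0 : E d) R, Φ x + inner ℝ (T x) (z - x) ≤ Φ z)
    {S : E d → E d} (hS : IsOptimalMap v (v.map T) S) : S =ᵐ[v] T := by
  have hv' : ∀ᵐ x ∂v, x ∈ closedBall (0 : E d) R := hv.mono fun x hx => ball_subset_closedBall hx
  filter_upwards [hd, hv, hsub, hS.subgradient hR hΦ hv' hT hTR hsub] with x h1 h2 h3 h4
  have hn : closedBall (0 : E d) R ∈ 𝓝 x :=
    mem_of_superset (isOpen_ball.mem_nhds h2) ball_subset_closedBall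
  exact (eq_gradient_of_subgradient hn h1 h4).trans (eq_gradient_of_subgradient hn h1 h3).symm

end Subgradient
-- Dual Kantorovich problem and Brenier's theorem
section Dual

variable {d : ℕ} {R : ℝ} {f g : E d → ℝ} {v μ : Measure (E d)}

theorem ballConj_le_add (hR : 0 ≤ R) (hf : Continuous f) (hg : Continuous g) {c : ℝ}
    (h : ∀ x ∈ closedBall (0 : E d) R, g x ≤ f x + c) (y : E d) :
    ballConj R f y ≤ ballConj R g y + c := by
  obtain ⟨x, hx, hx'⟩ := exists_ballConj_eq hR hf y
  have := le_ballConj hg hx y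
  have := h x hx
  linarith

/-- The objective of the dual Kantorovich problem. -/
noncomputable def dualCost (R : ℝ) (v μ : Measure (E d)) (f : E d → ℝ) : ℝ :=
  ∫ x, ballConj R f x ∂v + ∫ y, f y ∂μ

theorem dualCost_le_add (hR : 0 ≤ R) (hf : Continuous f) (hg : Continuous g)
    [IsProbabilityMeasure v] [IsProbabilityMeasure μ]
    (hv : ∀ᵐ x ∂v, x ∈ closedBall (0 : E d) R) (hμ : ∀ᵐ x ∂μ, x ∈ closedBall (0 : E d) R)
    {a b : ℝ} (ha : ∀ x ∈ closedBall (0 : E d) R, ballConj R f x ≤ ballConj R g x + a)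
    (hb : ∀ x ∈ closedBall (0 : E d) R, f x ≤ g x + b) :
    dualCost R v μ f ≤ dualCost R v μ g + (a + b) := by
  have hK := isCompact_closedBall (0 : E d) R
  have h1 := (ballConj_continuous hR hf).integrable_of_ae_mem_isCompact hK hv
  have h2 := (ballConj_continuous hR hg).integrable_of_ae_mem_isCompact hK hv
  have h3 := hf.integrable_of_ae_mem_isCompact hK hμ
  have h4 := hg.integrable_of_ae_mem_isCompact hK hμ
  have h5 : ∫ x, ballConj R f x ∂v ≤ ∫ x, (ballConj R g x + a) ∂v :=
    integral_mono_ae h1 (h2.add (integrable_const a)) (hv.mono ha)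
  have h6 : ∫ x, f x ∂μ ≤ ∫ x, (g x + b) ∂μ :=
    integral_mono_ae h3 (h4.add (integrable_const b)) (hμ.mono hb)
  rw [integral_add h2 (integrable_const a)] at h5
  rw [integral_add h4 (integrable_const b)] at h6
  simp only [integral_const, probReal_univ, one_smul] at h5 h6
  unfold dualCost
  linarith

/-- Radial retraction onto the closed ball. -/
noncomputable def ballRetract (hR : 0 < R) (x : E d) : closedBall (0 : E d) R :=
  ⟨(R / max R ‖x‖) • x, by
    have h : 0 < max R ‖x‖ := lt_max_of_lt_left hR
    rw [mem_closedBall_zero_iff, norm_smul, Real.norm_of_nonneg (by positivity),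
      div_mul_eq_mul_div, div_le_iff₀ h]
    exact mul_le_mul_of_nonneg_left (le_max_right _ _) hR.le⟩

theorem ballRetract_continuous (hR : 0 < R) : Continuous (ballRetract (d := d) hR) := by
  refine Continuous.subtype_mk ?_ _
  refine Continuous.smul (f := fun x : E d => R / max R ‖x‖)
    (continuous_const.div (continuous_const.max continuous_norm) fun x => ?_) continuous_id
  exact (lt_max_of_lt_left hR).ne'

theorem ballRetract_of_mem (hR : 0 < R) {x : E d} (hx : x ∈ closedBall (0 : E d) R) :
    ballRetract hR x = ⟨x, hx⟩ := by
  apply Subtype.ext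
  simp only [ballRetract]
  rw [max_eq_left (mem_closedBall_zero_iff.1 hx), div_self hR.ne', one_smul]

/-- The dual Kantorovich problem has a solution. -/
theorem exists_isMin_dualCost (hR : 0 < R) [IsProbabilityMeasure v] [IsProbabilityMeasure μ]
    (hv : ∀ᵐ x ∂v, x ∈ closedBall (0 : E d) R) (hμ : ∀ᵐ x ∂μ, x ∈ closedBall (0 : E d) R) :
    ∃ g : E d → ℝ, Continuous g ∧ ∀ h : E d → ℝ, Continuous h →
      dualCost R v μ g ≤ dualCost R v μ h := by
  have : CompactSpace (closedBall (0 : E d) R) :=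
    isCompact_iff_compactSpace.1 (isCompact_closedBall 0 R)
  let o : closedBall (0 : E d) R := ⟨0, mem_closedBall_self hR.le⟩
  -- Adding a constant to a potential does not change the dual cost, so potentials may be normalized
  -- at the origin; the Lipschitz bound is the one enjoyed by double conjugates.
  let A : Set (BoundedContinuousFunction (closedBall (0 : E d) R) ℝ) :=
    {u | LipschitzWith R.toNNReal u ∧ u o = 0}
  have heval : ∀ x, Continuous fun u : BoundedContinuousFunction (closedBall (0 : E d) R) ℝ => u x :=
    fun x => (continuous_apply x).comp BoundedContinuousFunction.continuous_coe
  have hAc : IsClosed A := by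
    have : A = (⋂ x, ⋂ y, {u | dist (u x) (u y) ≤ R.toNNReal * dist x y}) ∩ {u | u o = 0} := by
      ext u
      simp [A, lipschitzWith_iff_dist_le_mul]
    rw [this]
    refine IsClosed.inter (isClosed_iInter fun x => isClosed_iInter fun y => ?_) ?_
    · exact isClosed_le ((heval x).dist (heval y)) continuous_const
    · exact isClosed_eq (heval o) continuous_const
  have hA : IsCompact A := by
    refine BoundedContinuousFunction.arzela_ascoli₂ (closedBall 0 (R * R))
      (isCompact_closedBall _ _) A hAc ?_ ?_
    · intro u x hu
      have h1 := hu.1.dist_le_mul x o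
      rw [hu.2] at h1
      refine h1.trans ?_
      rw [Real.coe_toNNReal _ hR.le]
      exact mul_le_mul_of_nonneg_left x.2 hR.le
    · exact (LipschitzWith.uniformEquicontinuous _ R.toNNReal fun u => u.2.1).equicontinuous
  let ext : BoundedContinuousFunction (closedBall (0 : E d) R) ℝ → E d → ℝ :=
    fun u x => u (ballRetract hR x)
  have hext : ∀ u, Continuous (ext u) := fun u => u.continuous.comp (ballRetract_continuous hR)
  have hdist : ∀ u w x, ext u x ≤ ext w x + dist u w := fun u w x => by
    have := BoundedContinuousFunction.dist_coe_le_dist (f := u) (g := w) (ballRetract hR x)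
    rw [Real.dist_eq] at this
    have := (abs_le.1 this).2
    simp only [ext]
    linarith
  -- One unit comes from the conjugate, the other from the integral against `μ`.
  have hcost : LipschitzWith 2 fun u => dualCost R v μ (ext u) := by
    refine LipschitzWith.of_le_add_mul _ fun u w => ?_
    have := dualCost_le_add hR.le (hext u) (hext w) hv hμ
      (fun x _ => ballConj_le_add hR.le (hext u) (hext w)
        (fun x _ => dist_comm u w ▸ hdist w u x) x) (fun x _ => hdist u w x)
    rw [NNReal.coe_ofNat, two_mul]
    exact this
  obtain ⟨u, -, hu⟩ := hA.exists_isMinOn ⟨0, (LipschitzWith.const 0).weaken bot_le, rfl⟩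
    hcost.continuous.continuousOn
  refine ⟨ext u, hext u, fun h hh => ?_⟩
  have hc := ballConj_continuous hR.le hh
  have hcc := ballConj_continuous hR.le hc
  have hl := ballConj_lipschitz hR.le hc
  -- Any competitor `h` is replaced by its double conjugate: this does not raise it on the ball, nor
  -- does it raise the conjugate there. Subtracting `c` shifts the two integrals by `c` and `-c`.
  let c := ballConj R (ballConj R h) 0
  let w : BoundedContinuousFunction (closedBall (0 : E d) R) ℝ :=
    BoundedContinuousFunction.mkOfCompact
      ⟨fun x => ballConj R (ballConj R h) x - c, by fun_prop⟩
  have hwA : w ∈ A := by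
    refine ⟨?_, sub_self _⟩
    refine LipschitzWith.of_dist_le_mul fun x y => ?_
    have := hl.dist_le_mul x y
    rw [← dist_sub_right _ _ c] at this
    exact this
  have hwe : ∀ x ∈ closedBall (0 : E d) R, ext w x = ballConj R (ballConj R h) x - c := by
    intro x hx
    simp only [ext, ballRetract_of_mem hR hx]
    rfl
  refine (hu hwA).trans ?_
  have := dualCost_le_add hR.le (hext w) hh hv hμ (a := c) (b := -c) ?_ ?_
  · simpa using this
  · intro x hx
    obtain ⟨y, hy, hy'⟩ := exists_ballConj_eq hR.le (hext w) x
    rw [hy', hwe y hy]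
    have := le_ballConj hc hx y
    rw [real_inner_comm] at this
    linarith
  · intro x hx
    rw [hwe x hx]
    obtain ⟨y, hy, hy'⟩ := exists_ballConj_eq hR.le hc x
    rw [hy']
    have := le_ballConj hh hx y
    rw [real_inner_comm] at this
    linarith

/-- The gradient of a dual minimizer satisfies the transport inequality for test functions. -/
theorem integral_comp_gradient_le (hR : 0 < R) [IsProbabilityMeasure v] [IsProbabilityMeasure μ]
    (hv : ∀ᵐ x ∂v, x ∈ closedBall (0 : E d) R) (hμ : ∀ᵐ x ∂μ, x ∈ closedBall (0 : E d) R)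
    (hva : v ≪ volume) (hg : Continuous g)
    (hmin : ∀ h : E d → ℝ, Continuous h → dualCost R v μ g ≤ dualCost R v μ h)
    (h : BoundedContinuousFunction (E d) ℝ) :
    ∫ x, h (gradient (ballConj R g) x) ∂v ≤ ∫ y, h y ∂μ := by
  have hK := isCompact_closedBall (0 : E d) R
  let ε : ℕ → ℝ := fun n => 1 / ((n : ℝ) + 1)
  have hε : ∀ n, 0 < ε n := fun n => Nat.one_div_pos_of_nat
  have hε0 : Tendsto ε atTop (𝓝 0) := tendsto_one_div_add_atTop_nhds_zero_nat
  have hgc : ∀ n, Continuous fun y => g y + ε n * h y := fun n => by fun_prop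
  have hgi := hg.integrable_of_ae_mem_isCompact hK hμ
  have hhi := h.continuous.integrable_of_ae_mem_isCompact hK hμ
  have hci := (ballConj_continuous hR.le hg).integrable_of_ae_mem_isCompact hK hv
  have hcn := fun n => (ballConj_continuous hR.le (hgc n)).integrable_of_ae_mem_isCompact hK hv
  -- Difference quotients of the conjugate in the direction `h`; by the envelope principle they tend
  -- to `-h` at the maximizer wherever it is unique.
  let q : ℕ → E d → ℝ := fun n x =>
    (ballConj R (fun y => g y + ε n * h y) x - ballConj R g x) / ε n
  have hq0 : ∀ n, 0 ≤ ∫ x, q n x ∂v + ∫ y, h y ∂μ := by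
    intro n
    have := hmin _ (hgc n)
    unfold dualCost at this
    rw [integral_add hgi (hhi.const_mul _), integral_const_mul] at this
    simp only [q]
    rw [integral_div, integral_sub (hcn n) hci, div_add' _ _ _ (hε n).ne']
    refine div_nonneg ?_ (hε n).le
    linarith
  -- The witness maximizes the perturbed problem. It almost maximizes the original one: the
  -- perturbation costs at most `ε n * ‖h‖` at each of the two points compared.
  have hpt : ∀ n x, ∃ y ∈ closedBall (0 : E d) R, q n x ≤ - h y ∧
      ballConj R g x - 2 * ε n * ‖h‖ ≤ inner ℝ y x - g y := by
    intro n x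
    obtain ⟨y, hy, hy'⟩ := exists_ballConj_eq hR.le (hgc n) x
    refine ⟨y, hy, ?_, ?_⟩
    · simp only [q]
      rw [div_le_iff₀ (hε n), hy']
      have := le_ballConj hg hy x
      linarith
    · obtain ⟨z, hz, hz'⟩ := exists_ballConj_eq hR.le hg x
      have h1 := le_ballConj (hgc n) hz x
      rw [hy'] at h1
      have h2 := mul_le_mul_of_nonneg_left (abs_le.1 (h.norm_coe_le_norm z)).2 (hε n).le
      have h3 := mul_le_mul_of_nonneg_left (abs_le.1 (h.norm_coe_le_norm y)).1 (hε n).le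
      rw [hz']
      linarith
  have hlow : ∀ n x, ∀ y ∈ closedBall (0 : E d) R, ballConj R g x = inner ℝ y x - g y →
      - h y ≤ q n x := by
    intro n x y hy hy'
    simp only [q]
    rw [le_div_iff₀ (hε n), hy']
    have := le_ballConj (hgc n) hy x
    linarith
  have hlim : Tendsto (fun n => ∫ x, q n x ∂v) atTop
      (𝓝 (∫ x, - h (gradient (ballConj R g) x) ∂v)) := by
    refine tendsto_integral_of_dominated_convergence (fun _ => ‖h‖) ?_ (integrable_const _) ?_ ?_
    · intro n
      exact (((ballConj_continuous hR.le (hgc n)).sub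
        (ballConj_continuous hR.le hg)).div_const _).aestronglyMeasurable
    · intro n
      refine Eventually.of_forall fun x => ?_
      obtain ⟨y, hy, hy1, -⟩ := hpt n x
      obtain ⟨z, hz, hz'⟩ := exists_ballConj_eq hR.le hg x
      have h1 := hlow n x z hz hz'
      have h2 := (abs_le.1 (h.norm_coe_le_norm z)).2
      have h3 := (abs_le.1 (h.norm_coe_le_norm y)).1
      exact abs_le.2 ⟨by linarith, by linarith⟩
    · filter_upwards [ae_differentiableAt_ballConj hR.le hg hva] with x hx
      choose u hu hu1 hu2 using fun n => hpt n x
      have hu3 : Tendsto (fun n => inner ℝ (u n) x - g (u n)) atTop (𝓝 (ballConj R g x)) := by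
        refine tendsto_of_tendsto_of_tendsto_of_le_of_le ?_ tendsto_const_nhds hu2
          (fun n => le_ballConj hg (hu n) x)
        have : Tendsto (fun n => ballConj R g x - 2 * ε n * ‖h‖) atTop
            (𝓝 (ballConj R g x - 2 * 0 * ‖h‖)) :=
          tendsto_const_nhds.sub ((hε0.const_mul 2).mul_const _)
        simpa using this
      have hu4 := tendsto_gradient_ballConj hg hx hu hu3
      refine tendsto_of_tendsto_of_tendsto_of_le_of_le tendsto_const_nhds
        ((h.continuous.tendsto _).comp hu4).neg (fun n => ?_) hu1
      exact hlow n x _ (gradient_ballConj_mem hR.le hg hx) (ballConj_eq_gradient hR.le hg hx)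
  have := ge_of_tendsto' (hlim.add_const (∫ y, h y ∂μ)) hq0
  rw [integral_neg] at this
  linarith

/-- Brenier's theorem: an absolutely continuous measure is transported to any other measure on
the ball by the gradient of a convex function. -/
theorem exists_gradient_map_eq (hR : 0 < R) [IsProbabilityMeasure v] [IsProbabilityMeasure μ]
    (hv : ∀ᵐ x ∂v, x ∈ closedBall (0 : E d) R) (hμ : ∀ᵐ x ∂μ, x ∈ closedBall (0 : E d) R)
    (hva : v ≪ volume) :
    ∃ g : E d → ℝ, Continuous g ∧ v.map (gradient (ballConj R g)) = μ := by
  obtain ⟨g, hg, hmin⟩ := exists_isMin_dualCost hR hv hμ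
  refine ⟨g, hg, ?_⟩
  have hm := measurable_gradient (ballConj R g)
  have hp : IsProbabilityMeasure (v.map (gradient (ballConj R g))) :=
    Measure.isProbabilityMeasure_map hm.aemeasurable
  refine ext_of_forall_integral_eq_of_IsFiniteMeasure fun h => ?_
  rw [integral_map hm.aemeasurable h.continuous.aestronglyMeasurable]
  have h1 := integral_comp_gradient_le hR hv hμ hva hg hmin h
  -- The test functions form a linear space, so the inequality for `-h` upgrades it to equality.
  have h2 := integral_comp_gradient_le hR hv hμ hva hg hmin (-h)
  simp only [BoundedContinuousFunction.coe_neg, Pi.neg_apply, integral_neg] at h2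
  linarith

end Dual
-- Monotone approximations with finitely many values
section FiniteArgmax

variable {d : ℕ} {R : ℝ} {f : E d → ℝ}

/-- The least index `k ≤ n` at which `⟪y k, x⟫ - f (y k)` is maximal. -/
noncomputable def argmaxIdx (y : ℕ → E d) (f : E d → ℝ) : ℕ → E d → ℕ
  | 0, _ => 0
  | n + 1, x =>
    if inner ℝ (y (argmaxIdx y f n x)) x - f (y (argmaxIdx y f n x)) <
        inner ℝ (y (n + 1)) x - f (y (n + 1))
    then n + 1 else argmaxIdx y f n x

theorem argmaxIdx_le (y : ℕ → E d) (f : E d → ℝ) (n : ℕ) (x : E d) : argmaxIdx y f n x ≤ n := by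
  induction n with
  | zero => simp [argmaxIdx]
  | succ n ih =>
    rw [argmaxIdx]
    split_ifs
    · exact le_rfl
    · exact ih.trans n.le_succ

theorem le_argmaxIdx (y : ℕ → E d) (f : E d → ℝ) (x : E d) {k n : ℕ} (h : k ≤ n) :
    inner ℝ (y k) x - f (y k) ≤
      inner ℝ (y (argmaxIdx y f n x)) x - f (y (argmaxIdx y f n x)) := by
  induction n with
  | zero => simp [argmaxIdx, Nat.le_zero.1 h]
  | succ n ih =>
    rw [argmaxIdx]
    split_ifs with hlt
    · rcases Nat.le_succ_iff.1 h with h | rfl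
      · exact (ih h).trans hlt.le
      · exact le_rfl
    · rcases Nat.le_succ_iff.1 h with h | rfl
      · exact ih h
      · exact not_lt.1 hlt

theorem measurable_argmaxIdx (y : ℕ → E d) (hf : Continuous f) (n : ℕ) :
    Measurable (argmaxIdx y f n) := by
  induction n with
  | zero => exact measurable_const
  | succ n ih =>
    have hy : Measurable fun x => y (argmaxIdx y f n x) := (measurable_of_countable y).comp ih
    have hfy := hf.measurable.comp hy
    refine Measurable.ite (measurableSet_lt ?_ ?_) measurable_const ih
    · exact (hy.inner measurable_id).sub hfy
    · exact (Continuous.measurable (by fun_prop))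

/-- Each of the two selected indices competes at the other point; adding the two comparisons cancels
the values of `f`. -/
theorem argmaxIdx_monotone (y : ℕ → E d) (f : E d → ℝ) (n : ℕ) (x z : E d) :
    0 ≤ inner ℝ (y (argmaxIdx y f n x) - y (argmaxIdx y f n z)) (x - z) := by
  have h1 := le_argmaxIdx y f x (argmaxIdx_le y f n z)
  have h2 := le_argmaxIdx y f z (argmaxIdx_le y f n x)
  rw [inner_sub_left, inner_sub_right, inner_sub_right]
  linarith

/-- By density of `y`, the finite maxima approach the full supremum, so the selected points are
approximate maximizers. -/
theorem tendsto_argmaxIdx (hR : 0 ≤ R) (hf : Continuous f) {y : ℕ → E d}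
    (hy : ∀ n, y n ∈ closedBall (0 : E d) R) (hdense : closedBall (0 : E d) R ⊆ closure (range y))
    {x : E d} (hd : DifferentiableAt ℝ (ballConj R f) x) :
    Tendsto (fun n => y (argmaxIdx y f n x)) atTop (𝓝 (gradient (ballConj R f) x)) := by
  refine tendsto_gradient_ballConj hf hd (fun n => hy _) ?_
  refine tendsto_order.2 ⟨fun a ha => ?_, fun a ha => Eventually.of_forall fun n =>
    (le_ballConj hf (hy _) x).trans_lt ha⟩
  obtain ⟨p, hp, hp'⟩ := exists_ballConj_eq hR hf x
  rw [hp'] at ha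
  have hopen : IsOpen {w : E d | a < inner ℝ w x - f w} :=
    isOpen_lt continuous_const (by fun_prop)
  obtain ⟨w, hw, k, rfl⟩ := mem_closure_iff.1 (hdense hp) _ hopen ha
  filter_upwards [eventually_ge_atTop k] with n hn
  exact lt_of_lt_of_le hw (le_argmaxIdx y f x hn)

end FiniteArgmax

/-! ### Density bound for the interpolated map -/

section Density

variable {d : ℕ} {R τ : ℝ} {v : Measure (E d)} {c : ℝ≥0∞}

theorem measurable_combo {F G : E d → E d} (hF : Measurable F) (hG : Measurable G) (a b : ℝ) :
    Measurable fun x => a • F x + b • G x :=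
  (hF.const_smul a).add (hG.const_smul b)

/-- Density bound for an injective convex combination of a countably valued map with a map whose
push-forward has bounded density. -/
theorem measure_preimage_combo_le {N : Set (E d)} (hN : MeasurableSet N) (hNv : v Nᶜ = 0)
    {k : E d → ℕ} (hk : Measurable k) (y : ℕ → E d) {G : E d → E d} (hG : Measurable G)
    (hGc : v.map G ≤ c • volume) (hτ : 0 < τ)
    (hinj : InjOn (fun x => (1 - τ) • y (k x) + τ • G x) N) {A : Set (E d)}
    (hA : MeasurableSet A) :
    v ((fun x => (1 - τ) • y (k x) + τ • G x) ⁻¹' A) ≤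
      c * (ENNReal.ofReal (τ ^ d))⁻¹ * volume A := by
  set H : E d → E d := fun x => (1 - τ) • y (k x) + τ • G x with hH
  have hHm : Measurable H :=
    measurable_combo ((measurable_of_countable y).comp hk) hG _ _
  -- On each piece the first term is constant, so `H` is a translate of `τ • G` and `G` inherits
  -- injectivity from `H`.
  let Z : ℕ → Set (E d) := fun i => (N ∩ H ⁻¹' A) ∩ k ⁻¹' {i}
  have hZm : ∀ i, MeasurableSet (Z i) := fun i =>
    (hN.inter (hHm hA)).inter (hk (measurableSet_singleton i))
  have hZN : ∀ i, Z i ⊆ N := fun i x hx => hx.1.1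
  have hHi : ∀ i, ∀ x ∈ Z i, H x = (1 - τ) • y i + τ • G x := by
    intro i x hx
    have : k x = i := hx.2
    simp only [hH, this]
  have hGinj : ∀ i, InjOn G (Z i) := fun i x hx z hz hxz =>
    hinj (hZN i hx) (hZN i hz) (by
      rw [hHi i x hx, hHi i z hz, hxz])
  have hτd : ENNReal.ofReal (τ ^ d) ≠ 0 := by
    rw [Ne, ENNReal.ofReal_eq_zero, not_le]
    positivity
  have himg : ∀ i, volume (H '' Z i) = ENNReal.ofReal (τ ^ d) * volume (G '' Z i) := by
    intro i
    have h1 : H '' Z i = (fun w => (1 - τ) • y i + w) '' ((fun w => τ • w) '' (G '' Z i)) := by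
      rw [image_image, image_image]
      exact image_congr (hHi i)
    rw [h1, image_add_left, measure_preimage_add, image_smul, Measure.addHaar_smul,
      finrank_euclideanSpace_fin, abs_of_pos (by positivity)]
  have hZ : ∀ i, v (Z i) ≤ c * (ENNReal.ofReal (τ ^ d))⁻¹ * volume (H '' Z i) := by
    intro i
    have hm : MeasurableSet (G '' Z i) := (hZm i).image_of_measurable_injOn hG (hGinj i)
    calc v (Z i) ≤ v (G ⁻¹' (G '' Z i)) := measure_mono (subset_preimage_image _ _)
      _ = v.map G (G '' Z i) := (Measure.map_apply hG hm).symm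
      _ ≤ c * volume (G '' Z i) := hGc _
      _ = c * (ENNReal.ofReal (τ ^ d))⁻¹ * volume (H '' Z i) := by
        rw [himg, mul_assoc, ← mul_assoc _ (ENNReal.ofReal (τ ^ d)),
          ENNReal.inv_mul_cancel hτd ENNReal.ofReal_ne_top, one_mul]
  have hdisj : Pairwise (Function.onFun Disjoint fun i => H '' Z i) := by
    intro i j hij
    refine disjoint_left.2 ?_
    rintro _ ⟨x, hx, rfl⟩ ⟨z, hz, hxz⟩
    have hxz : z = x := hinj (hZN j hz) (hZN i hx) hxz
    subst hxz
    have h1 : k z = i := hx.2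
    have h2 : k z = j := hz.2
    exact hij (h1.symm.trans h2)
  calc v (H ⁻¹' A) ≤ v ((⋃ i, Z i) ∪ Nᶜ) := by
        refine measure_mono fun x hx => ?_
        by_cases hxN : x ∈ N
        · exact Or.inl (mem_iUnion.2 ⟨k x, ⟨hxN, hx⟩, rfl⟩)
        · exact Or.inr hxN
    _ ≤ v (⋃ i, Z i) + v Nᶜ := measure_union_le _ _
    _ = v (⋃ i, Z i) := by rw [hNv, add_zero]
    _ ≤ ∑' i, v (Z i) := measure_iUnion_le _
    _ ≤ ∑' i, c * (ENNReal.ofReal (τ ^ d))⁻¹ * volume (H '' Z i) := ENNReal.tsum_le_tsum hZ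
    _ = c * (ENNReal.ofReal (τ ^ d))⁻¹ * volume (⋃ i, H '' Z i) := by
        rw [ENNReal.tsum_mul_left, measure_iUnion hdisj fun i =>
          (hZm i).image_of_measurable_injOn hHm (hinj.mono (hZN i))]
    _ ≤ c * (ENNReal.ofReal (τ ^ d))⁻¹ * volume A := by
        gcongr
        refine iUnion_subset fun i => ?_
        rintro _ ⟨x, hx, rfl⟩
        exact hx.1.2

/-- A bound on the density of push-forwards passes to almost everywhere limits of the maps. -/
theorem map_le_smul_of_tendsto {b : ℝ≥0∞} (hb : b ≠ ∞) {H : E d → E d} (hH : Measurable H)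
    {u : ℕ → E d → E d} (hu : ∀ᵐ x ∂v, Tendsto (fun n => u n x) atTop (𝓝 (H x)))
    (hle : ∀ n O, IsOpen O → v (u n ⁻¹' O) ≤ b * volume O) :
    v.map H ≤ b • volume := by
  have hopen : ∀ O, IsOpen O → v (H ⁻¹' O) ≤ b * volume O := by
    intro O hO
    -- Fatou for sets: a limit in the open set `O` forces the sequence to stay in `O` eventually.
    let B : ℕ → Set (E d) := fun m => ⋂ n ≥ m, u n ⁻¹' O
    have hB : Monotone B := fun m m' hm =>
      biInter_mono (fun n (hn : m' ≤ n) => hm.trans hn) fun _ _ => Subset.rfl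
    calc v (H ⁻¹' O) ≤ v (⋃ m, B m) := by
          refine measure_mono_ae ?_
          filter_upwards [hu] with x hx hxO
          obtain ⟨m, hm⟩ := eventually_atTop.1 (hx.eventually (hO.mem_nhds hxO))
          exact mem_iUnion.2 ⟨m, mem_iInter₂.2 hm⟩
      _ = ⨆ m, v (B m) := hB.measure_iUnion
      _ ≤ b * volume O := iSup_le fun m =>
          (measure_mono (biInter_subset_of_mem (le_refl m))).trans (hle m O hO)
  refine Measure.le_iff.2 fun A hA => ?_
  rw [Measure.map_apply hH hA, Measure.smul_apply, smul_eq_mul]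
  -- Pulling `b` out of the infimum over open supersets requires it to be nonzero and finite.
  rcases eq_or_ne b 0 with rfl | hb0
  · have := hopen univ isOpen_univ
    rw [zero_mul] at this ⊢
    exact (measure_mono (subset_univ _)).trans this
  rw [A.measure_eq_iInf_isOpen (μ := volume)]
  simp_rw [ENNReal.mul_iInf_of_ne hb0 hb]
  exact le_iInf fun O => le_iInf fun hAO => le_iInf fun hO =>
    (measure_mono (preimage_mono hAO)).trans (hopen O hO)

/-- The gradient of the potential is strictly monotone where the conjugate potential is
differentiable. -/
theorem eq_of_inner_gradient_eq_zero (hR : 0 ≤ R) {g : E d → ℝ} (hg : Continuous g) {x z : E d}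
    (hx : x ∈ closedBall (0 : E d) R) (hz : z ∈ closedBall (0 : E d) R)
    (hdx : DifferentiableAt ℝ (ballConj R g) x) (hdz : DifferentiableAt ℝ (ballConj R g) z)
    (hd : DifferentiableAt ℝ (ballConj R (ballConj R g)) (gradient (ballConj R g) z))
    (h : inner ℝ (gradient (ballConj R g) x - gradient (ballConj R g) z) (x - z) ≤ 0) :
    x = z := by
  have hsub : ∀ {x}, DifferentiableAt ℝ (ballConj R g) x → ∀ z,
      ballConj R g x + inner ℝ (gradient (ballConj R g) x) (z - x) ≤ ballConj R g z :=
    fun hx z => ballConj_subgradient hg (gradient_ballConj_mem hR hg hx)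
      (ballConj_eq_gradient hR hg hx) z
  have hc := ballConj_continuous hR hg
  have h1 := hsub hdx z
  set q := gradient (ballConj R g) z with hq
  set p := gradient (ballConj R g) x with hp
  rw [inner_sub_left, inner_sub_right, inner_sub_right] at h
  rw [inner_sub_right] at h1
  obtain ⟨w, hw, hw'⟩ := exists_ballConj_eq hR hc q
  have h2 := hsub hdz w
  rw [← hq, inner_sub_right, real_inner_comm] at h2
  have h3 := le_ballConj hc hz q
  have h4 := le_ballConj hc hx q
  have h5 := real_inner_comm q z
  have h6 := real_inner_comm q x
  -- Without a strict monotonicity gap, `x` and `z` both attain the double conjugate at `q`, where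
  -- differentiability allows only one maximizer.
  have e1 : ballConj R (ballConj R g) q = inner ℝ z q - ballConj R g z := by linarith
  have e2 : ballConj R (ballConj R g) q = inner ℝ x q - ballConj R g x := by linarith
  exact (eq_gradient_ballConj hc hx hd e2).trans (eq_gradient_ballConj hc hz hd e1).symm

/-- Density bound along generalized geodesics. -/
theorem map_combo_gradient_le (hR : 0 < R) (hva : v ≪ volume)
    (hv : ∀ᵐ x ∂v, x ∈ closedBall (0 : E d) R) {f g : E d → ℝ} (hf : Continuous f)
    (hg : Continuous g) (hc : c ≠ ∞) (hGc : v.map (gradient (ballConj R g)) ≤ c • volume)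
    (hτ : 0 < τ) (hτ1 : τ ≤ 1) :
    v.map (fun x => (1 - τ) • gradient (ballConj R f) x + τ • gradient (ballConj R g) x) ≤
      (c * (ENNReal.ofReal (τ ^ d))⁻¹) • volume := by
  have hFm := measurable_gradient (ballConj R f)
  have hGm := measurable_gradient (ballConj R g)
  have hgc := ballConj_continuous hR.le hg
  have hne : Nonempty (closedBall (0 : E d) R) := ⟨⟨0, mem_closedBall_self hR.le⟩⟩
  let y : ℕ → E d := fun n => (TopologicalSpace.denseSeq (closedBall (0 : E d) R) n : E d)
  have hy : ∀ n, y n ∈ closedBall (0 : E d) R := fun n => Subtype.coe_prop _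
  have hdense : closedBall (0 : E d) R ⊆ closure (range y) := by
    intro x hx
    have h1 := (TopologicalSpace.denseRange_denseSeq (closedBall (0 : E d) R)) ⟨x, hx⟩
    have h2 := image_closure_subset_closure_image continuous_subtype_val (mem_image_of_mem _ h1)
    rwa [← range_comp] at h2
  -- The set where the gradient of `ballConj R g` is strictly monotone. The last condition holds
  -- almost everywhere because the image measure is absolutely continuous.
  let N : Set (E d) := closedBall 0 R ∩ {x | DifferentiableAt ℝ (ballConj R g) x} ∩
    gradient (ballConj R g) ⁻¹' {q | DifferentiableAt ℝ (ballConj R (ballConj R g)) q}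
  have hN : MeasurableSet N :=
    (measurableSet_closedBall.inter (measurableSet_of_differentiableAt ℝ _)).inter
      (hGm (measurableSet_of_differentiableAt ℝ _))
  have hNv : v Nᶜ = 0 := by
    have hGa : v.map (gradient (ballConj R g)) ≪ volume :=
      (Measure.absolutelyContinuous_of_le hGc).trans Measure.smul_absolutelyContinuous
    have h1 := ae_of_ae_map hGm.aemeasurable (ae_differentiableAt_ballConj hR.le hgc hGa)
    have : ∀ᵐ x ∂v, x ∈ N := by
      filter_upwards [hv, ae_differentiableAt_ballConj hR.le hg hva, h1] with x a b c'
      exact ⟨⟨a, b⟩, c'⟩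
    exact this
  have hτd : ENNReal.ofReal (τ ^ d) ≠ 0 := by
    rw [Ne, ENNReal.ofReal_eq_zero, not_le]
    positivity
  refine map_le_smul_of_tendsto (ENNReal.mul_ne_top hc (ENNReal.inv_ne_top.2 hτd))
    (measurable_combo hFm hGm _ _)
    (u := fun n x => (1 - τ) • y (argmaxIdx y f n x) + τ • gradient (ballConj R g) x) ?_ ?_
  · filter_upwards [ae_differentiableAt_ballConj hR.le hf hva] with x hx
    exact ((tendsto_argmaxIdx hR.le hf hy hdense hx).const_smul _).add tendsto_const_nhds
  · intro n O hO
    refine measure_preimage_combo_le hN hNv (measurable_argmaxIdx y hf n) y hGm hGc hτ ?_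
      hO.measurableSet
    intro x hx z hz hxz
    refine eq_of_inner_gradient_eq_zero hR.le hg hx.1.1 hz.1.1 hx.1.2 hz.1.2 hz.2 ?_
    -- If two images coincide, pairing their difference with `x - z` gives a sum equal to zero; its
    -- first term is nonnegative, so the second cannot be positive.
    have h1 := argmaxIdx_monotone y f n x z
    have h2 : (1 - τ) • (y (argmaxIdx y f n x) - y (argmaxIdx y f n z)) +
        τ • (gradient (ballConj R g) x - gradient (ballConj R g) z) = 0 := by
      simp only at hxz
      rw [smul_sub, smul_sub, sub_add_sub_comm, hxz, sub_self]
    have h3 := congrArg (fun w => inner ℝ w (x - z)) h2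
    simp only [inner_add_left, real_inner_smul_left, inner_zero_left] at h3
    have h4 := mul_nonneg (sub_nonneg.2 hτ1) h1
    by_contra! hcon
    have := mul_pos hτ hcon
    linarith

end Density
-- Generalized geodesics towards the uniform measure
section Geodesic

variable {d : ℕ} {R τ : ℝ} {v μ : Measure (E d)}

theorem ae_subgradient_ballConj (hR : 0 ≤ R) (hva : v ≪ volume) {f : E d → ℝ}
    (hf : Continuous f) : ∀ᵐ x ∂v, ∀ z,
      ballConj R f x + inner ℝ (gradient (ballConj R f) x) (z - x) ≤ ballConj R f z := by
  filter_upwards [ae_differentiableAt_ballConj hR hf hva] with x hx z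
  exact ballConj_subgradient hf (gradient_ballConj_mem hR hf hx) (ballConj_eq_gradient hR hf hx) z

theorem isOptimalMap_optimalMap {T : E d → E d} (hT : IsOptimalMap v μ T) :
    IsOptimalMap v μ (optimalMap v μ) :=
  Classical.epsilon_spec (p := IsOptimalMap v μ) ⟨T, hT⟩

/-- Convex combinations of gradients of potentials are the unique optimal maps to their images. -/
theorem optimalMap_combo_gradient (hR : 0 < R) [IsProbabilityMeasure v]
    (hv : ∀ᵐ x ∂v, x ∈ ball (0 : E d) R) (hva : v ≪ volume) {f g : E d → ℝ} (hf : Continuous f)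
    (hg : Continuous g) (hτ : 0 ≤ τ) (hτ1 : τ ≤ 1) {T : E d → E d}
    (hT : T = fun x => (1 - τ) • gradient (ballConj R f) x + τ • gradient (ballConj R g) x) :
    IsOptimalMap v (v.map T) (optimalMap v (v.map T)) ∧ optimalMap v (v.map T) =ᵐ[v] T := by
  have hv' : ∀ᵐ x ∂v, x ∈ closedBall (0 : E d) R := hv.mono fun x hx => ball_subset_closedBall hx
  have hfc := ballConj_continuous hR.le hf
  have hgc := ballConj_continuous hR.le hg
  have hTm : Measurable T :=
    hT ▸ measurable_combo (measurable_gradient _) (measurable_gradient _) _ _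
  have hΦ : Continuous fun x => (1 - τ) * ballConj R f x + τ * ballConj R g x := by fun_prop
  have hdf := ae_differentiableAt_ballConj hR.le hf hva
  have hdg := ae_differentiableAt_ballConj hR.le hg hva
  have hTR : ∀ᵐ x ∂v, T x ∈ closedBall (0 : E d) R := by
    filter_upwards [hdf, hdg] with x h1 h2
    rw [hT]
    exact convex_closedBall 0 R (gradient_ballConj_mem hR.le hf h1)
      (gradient_ballConj_mem hR.le hg h2) (sub_nonneg.2 hτ1) hτ (by ring)
  have hsub : ∀ᵐ x ∂v, ∀ z ∈ closedBall (0 : E d) R,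
      ((1 - τ) * ballConj R f x + τ * ballConj R g x) + inner ℝ (T x) (z - x) ≤
        (1 - τ) * ballConj R f z + τ * ballConj R g z := by
    filter_upwards [ae_subgradient_ballConj hR.le hva hf, ae_subgradient_ballConj hR.le hva hg]
      with x h1 h2 z _
    have h3 := mul_le_mul_of_nonneg_left (h1 z) (sub_nonneg.2 hτ1)
    have h4 := mul_le_mul_of_nonneg_left (h2 z) hτ
    rw [hT]
    simp only [inner_add_left, real_inner_smul_left]
    linarith
  have hopt := isOptimalMap_optimalMap (isOptimalMap_of_subgradient hR.le hΦ hv' hTm hTR hsub)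
  refine ⟨hopt, hopt.ae_eq_of_subgradient hR.le hΦ ?_ hv hTm hTR hsub⟩
  filter_upwards [hdf, hdg] with x h1 h2
  exact (h1.const_mul _).add (h2.const_mul _)

/-- Existence and uniqueness of optimal maps from absolutely continuous measures. -/
theorem exists_optimalMap_ae_eq_gradient (hR : 0 < R) [IsProbabilityMeasure v]
    [IsProbabilityMeasure μ] (hv : ∀ᵐ x ∂v, x ∈ ball (0 : E d) R)
    (hμ : ∀ᵐ x ∂μ, x ∈ closedBall (0 : E d) R) (hva : v ≪ volume) :
    ∃ f : E d → ℝ, Continuous f ∧ IsOptimalMap v μ (optimalMap v μ) ∧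
      optimalMap v μ =ᵐ[v] gradient (ballConj R f) := by
  obtain ⟨f, hf, rfl⟩ := exists_gradient_map_eq hR
    (hv.mono fun x hx => ball_subset_closedBall hx) hμ hva
  -- At `τ = 0` the combination is a single gradient.
  have h := optimalMap_combo_gradient hR hv hva hf hf (τ := 0) le_rfl zero_le_one
    (T := gradient (ballConj R f)) (by simp)
  exact ⟨f, hf, h.1, h.2⟩

theorem rnDeriv_le_of_le_smul {b : ℝ≥0∞} (h : μ ≤ b • volume) :
    ∀ᵐ x ∂(volume : Measure (E d)), μ.rnDeriv volume x ≤ b := by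
  refine ae_le_of_forall_setLIntegral_le_of_sigmaFinite (g := fun _ => b)
    (Measure.measurable_rnDeriv _ _) fun A _ _ => ?_
  rw [setLIntegral_const]
  exact (Measure.setLIntegral_rnDeriv_le A).trans (h A)

theorem pseudoWasserstein_le {μ' : Measure (E d)} [IsProbabilityMeasure v] {r : ℝ}
    (h : ∀ᵐ x ∂v, ‖optimalMap v μ x - optimalMap v μ' x‖ ≤ r) :
    pseudoWasserstein v μ μ' ≤ ENNReal.ofReal r := by
  have h1 : ∫⁻ x, ‖optimalMap v μ x - optimalMap v μ' x‖ₑ ^ 2 ∂v ≤ ENNReal.ofReal r ^ 2 := by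
    calc _ ≤ ∫⁻ _, ENNReal.ofReal r ^ 2 ∂v := by
          refine lintegral_mono_ae ?_
          filter_upwards [h] with x hx
          rw [← ofReal_norm]
          gcongr
      _ = ENNReal.ofReal r ^ 2 := by simp
  refine (ENNReal.rpow_le_rpow h1 (by norm_num)).trans_eq ?_
  rw [← ENNReal.rpow_natCast, ← ENNReal.rpow_mul]
  norm_num

theorem isProbabilityMeasure_uniform {Ω : Set (E d)} (h0 : volume Ω ≠ 0) (h1 : volume Ω ≠ ∞) :
    IsProbabilityMeasure (uniform Ω) := by
  constructor
  simp [uniform, ENNReal.inv_mul_cancel h0 h1]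

theorem uniform_le_smul (Ω : Set (E d)) : uniform Ω ≤ (volume Ω)⁻¹ • volume := by
  intro A
  exact mul_le_mul_right (Measure.restrict_le_self A) _

/-- The frontier of a convex set is null. Since points strictly between the closure and the interior
are interior, the interpolated measure lives on `Ω` although `μ` may charge the boundary. -/
theorem ae_uniform_mem_interior {Ω : Set (E d)} (hΩ : Convex ℝ Ω) :
    ∀ᵐ x ∂(uniform Ω), x ∈ interior Ω := by
  have h : volume ((interior Ω)ᶜ ∩ Ω) = 0 :=
    measure_mono_null (t := frontier Ω) (fun x hx => ⟨subset_closure hx.2, hx.1⟩) (hΩ.addHaar_frontier volume)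
  change uniform Ω (interior Ω)ᶜ = 0
  rw [uniform, Measure.smul_apply, Measure.restrict_apply isOpen_interior.measurableSet.compl, h,
    smul_zero]

theorem div_rpow_inv_pow {V s : ℝ} (hV : 0 < V) (hd : 1 ≤ d) :
    V * (s / V ^ ((1 : ℝ) / (d : ℝ))) ^ d = s ^ d := by
  rw [div_pow, one_div, Real.rpow_inv_natCast_pow hV.le (by omega), mul_div_cancel₀ _ hV.ne']

/-- Removes the dimension from the constants: they must depend on `V` alone. -/
theorem min_one_le_rpow {V : ℝ} (hV : 0 < V) (hd : 1 ≤ d) :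
    min 1 V ≤ V ^ ((1 : ℝ) / (d : ℝ)) := by
  have hd' : (1 : ℝ) ≤ d := by exact_mod_cast hd
  rcases le_total 1 V with h | h
  · exact (min_le_left _ _).trans (Real.one_le_rpow h (by positivity))
  · refine (min_le_right _ _).trans ?_
    conv_lhs => rw [← Real.rpow_one V]
    exact Real.rpow_le_rpow_of_exponent_ge hV h (by rw [div_le_one (by linarith)]; exact hd')

theorem IsP2a.generalizedGeodesic_uniform {Ω : Set (E d)} (hb : Bornology.IsBounded Ω)
    (hΩ : Convex ℝ Ω) (hV : 0 < volume.real Ω) (hμ : IsP2 (closure Ω) μ) (hv : IsP2a Ω v)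
    (hτ : 0 < τ) (hτ1 : τ ≤ 1) {μs : Measure (E d)}
    (hμs : μs = generalizedGeodesic v μ (uniform Ω) τ) :
    IsP2a Ω μs ∧ IsOptimalMap v μ (optimalMap v μ) ∧ IsOptimalMap v μs (optimalMap v μs) ∧
      IsOptimalMap v (uniform Ω) (optimalMap v (uniform Ω)) ∧
      pseudoWasserstein v μ μs ≤ ENNReal.ofReal (τ * Metric.diam Ω) ∧
      μs ≤ ENNReal.ofReal ((volume.real Ω * τ ^ d)⁻¹) • volume := by
  have hvol0 : volume Ω ≠ 0 := fun h => by simp [Measure.real, h] at hV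
  have hvolt : volume Ω ≠ ∞ := hb.measure_lt_top.ne
  have := hμ.prob
  have := hv.prob
  have := isProbabilityMeasure_uniform hvol0 hvolt
  have hva := hv.absCont
  obtain ⟨R, hR, hΩR⟩ := hb.subset_ball_lt 0 0
  have hcl : closure Ω ⊆ closedBall (0 : E d) R :=
    closure_minimal (hΩR.trans ball_subset_closedBall) isClosed_closedBall
  have hvΩ : ∀ᵐ x ∂v, x ∈ Ω := hv.carried
  have hvR : ∀ᵐ x ∂v, x ∈ ball (0 : E d) R := hvΩ.mono fun x hx => hΩR hx
  have hμΩ : ∀ᵐ x ∂μ, x ∈ closure Ω := hμ.carried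
  have heΩ := ae_uniform_mem_interior hΩ
  obtain ⟨f, hf, hFopt, hF⟩ := exists_optimalMap_ae_eq_gradient hR hvR
    (hμΩ.mono fun x hx => hcl hx) hva
  obtain ⟨g, hg, hGopt, hG⟩ := exists_optimalMap_ae_eq_gradient hR hvR
    (heΩ.mono fun x hx => hcl (subset_closure (interior_subset hx))) hva
  have hFΩ : ∀ᵐ x ∂v, optimalMap v μ x ∈ closure Ω :=
    ae_of_ae_map hFopt.measurable.aemeasurable (hFopt.map_eq.symm ▸ hμΩ)
  have hGΩ : ∀ᵐ x ∂v, optimalMap v (uniform Ω) x ∈ interior Ω :=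
    ae_of_ae_map hGopt.measurable.aemeasurable (hGopt.map_eq.symm ▸ heΩ)
  set T : E d → E d :=
    fun x => (1 - τ) • gradient (ballConj R f) x + τ • gradient (ballConj R g) x with hT
  set H : E d → E d :=
    fun x => (1 - τ) • optimalMap v μ x + τ • optimalMap v (uniform Ω) x with hH
  have hHm : Measurable H := measurable_combo hFopt.measurable hGopt.measurable _ _
  have hHT : H =ᵐ[v] T := by
    filter_upwards [hF, hG] with x h1 h2
    simp only [hH, hT, h1, h2]
  have hμsH : μs = v.map H := hμs
  have hμsT : μs = v.map T := hμsH.trans (Measure.map_congr hHT)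
  have hHΩ : ∀ᵐ x ∂v, H x ∈ interior Ω := by
    filter_upwards [hFΩ, hGΩ] with x h1 h2
    exact hΩ.combo_closure_interior_mem_interior h1 h2 (sub_nonneg.2 hτ1) hτ (by ring)
  have hμsΩ : ∀ᵐ x ∂μs, x ∈ interior Ω := by
    rw [hμsH]
    exact (ae_map_iff hHm.aemeasurable isOpen_interior.measurableSet).2 hHΩ
  have hprob : IsProbabilityMeasure μs := hμsH ▸ Measure.isProbabilityMeasure_map hHm.aemeasurable
  have hle : μs ≤ ENNReal.ofReal ((volume.real Ω * τ ^ d)⁻¹) • volume := by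
    have hGc : v.map (gradient (ballConj R g)) ≤ (volume Ω)⁻¹ • volume := by
      rw [← Measure.map_congr hG, hGopt.map_eq]
      exact uniform_le_smul Ω
    have := map_combo_gradient_le hR hva (hvR.mono fun x hx => ball_subset_closedBall hx) hf hg
      (ENNReal.inv_ne_top.2 hvol0) hGc hτ hτ1
    rw [hμsT]
    refine this.trans_eq ?_
    rw [← ENNReal.ofReal_toReal hvolt, mul_inv, ENNReal.ofReal_mul (by positivity),
      ENNReal.ofReal_inv_of_pos hV,
      ENNReal.ofReal_inv_of_pos (by positivity)]
    rfl
  obtain ⟨hsopt, hs⟩ := optimalMap_combo_gradient hR hvR hva hf hg hτ.le hτ1 hT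
  rw [← hμsT] at hsopt hs
  refine ⟨⟨⟨hprob, ?_, ?_⟩, ?_⟩, hFopt, hsopt, hGopt, ?_, hle⟩
  · exact hμsΩ.mono fun x hx => interior_subset hx
  · calc ∫⁻ x, ‖x‖ₑ ^ 2 ∂μs ≤ ∫⁻ _, ENNReal.ofReal R ^ 2 ∂μs := by
          refine lintegral_mono_ae ?_
          filter_upwards [hμsΩ] with x hx
          rw [← ofReal_norm]
          gcongr
          exact mem_closedBall_zero_iff.1 (hcl (subset_closure (interior_subset hx)))
      _ < ∞ := by simp
  · exact (Measure.absolutelyContinuous_of_le hle).trans Measure.smul_absolutelyContinuous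
  · refine pseudoWasserstein_le ?_
    filter_upwards [hs, hHT, hFΩ, hGΩ] with x h1 h2 h3 h4
    -- The optimal map to `μs` is the interpolation itself, so the displacement is a `τ`-fraction of
    -- a segment with both ends in the closure of `Ω`.
    have h5 : optimalMap v μ x - optimalMap v μs x =
        τ • (optimalMap v μ x - optimalMap v (uniform Ω) x) := by
      rw [h1, ← h2]
      simp only [hH]
      module
    rw [h5, norm_smul, Real.norm_of_nonneg hτ.le, ← dist_eq_norm, ← Metric.diam_closure]
    exact mul_le_mul_of_nonneg_left
      (dist_le_diam_of_mem hb.closure h3 (subset_closure (interior_subset h4))) hτ.le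

end Geodesic
end Transport

/-! ### Choice of constants -/

theorem lemma4p5 (D V : ℝ) :
    ∃ C > (0 : ℝ), ∃ s₀ > (0 : ℝ),
      ∀ (d : ℕ), 1 ≤ d →
      ∀ Ω : Set (Transport.E d), Bornology.IsBounded Ω → Convex ℝ Ω →
        Metric.diam Ω = D → volume.real Ω = V →
      ∀ μ v : Measure (Transport.E d),
        Transport.IsP2 (closure Ω) μ → Transport.IsP2a Ω v →
      ∀ s : ℝ, 0 < s → s < s₀ →
      ∃ μs : Measure (Transport.E d),
        Transport.IsP2a Ω μs ∧
        -- the optimal maps that are used below exist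
        Transport.IsOptimalMap v μ (Transport.optimalMap v μ) ∧
        Transport.IsOptimalMap v μs (Transport.optimalMap v μs) ∧
        Transport.IsOptimalMap v (Transport.uniform Ω)
          (Transport.optimalMap v (Transport.uniform Ω)) ∧
        -- `μs` lies on the generalized geodesic from `μ` to the uniform measure with base `v`
        s / V ^ ((1 : ℝ) / (d : ℝ)) ≤ 1 ∧
        μs = Transport.generalizedGeodesic v μ (Transport.uniform Ω)
          (s / V ^ ((1 : ℝ) / (d : ℝ))) ∧
        Transport.pseudoWasserstein v μ μs ≤ ENNReal.ofReal (C * s) ∧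
        ∀ᵐ x ∂(volume : Measure (Transport.E d)),
          μs.rnDeriv volume x ≤ ENNReal.ofReal ((s ^ d)⁻¹) := by
  -- For `V ≤ 0` the set `Ω` is null and cannot carry an absolutely continuous probability measure.
  rcases le_or_gt V 0 with hV | hV
  · refine ⟨1, one_pos, 1, one_pos, fun d _ Ω hb _ _ hΩV μ v _ hv => ?_⟩
    have := hv.prob
    have h0 : volume Ω = 0 :=
      (measureReal_eq_zero_iff hb.measure_lt_top.ne).1
        (le_antisymm (hΩV.trans_le hV) measureReal_nonneg)
    have h1 : v Set.univ ≤ v Ω + v Ωᶜ := by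
      rw [← Set.union_compl_self Ω]
      exact measure_union_le _ _
    rw [hv.absCont h0, hv.carried, measure_univ, add_zero] at h1
    exact absurd h1 (by simp)
  have hm : 0 < min 1 V := lt_min one_pos hV
  -- The threshold `min 1 V` ensures `τ ≤ 1` in every dimension. Constants precede `Ω`, so `D` may
  -- be any real number; `|D| + 1` is positive and dominates it.
  refine ⟨(|D| + 1) / min 1 V, by positivity, min 1 V, hm, ?_⟩
  intro d hd Ω hb hΩ hD hΩV μ v hμ hv s hs hs0
  have hVd := Transport.min_one_le_rpow hV hd
  have hVd0 : 0 < V ^ ((1 : ℝ) / (d : ℝ)) := hm.trans_le hVd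
  have hτ : 0 < s / V ^ ((1 : ℝ) / (d : ℝ)) := div_pos hs hVd0
  have hτ1 : s / V ^ ((1 : ℝ) / (d : ℝ)) ≤ 1 := (div_le_one hVd0).2 (hs0.le.trans hVd)
  obtain ⟨h1, h2, h3, h4, h5, h6⟩ := Transport.IsP2a.generalizedGeodesic_uniform hb hΩ
    (hΩV ▸ hV) hμ hv hτ hτ1 rfl
  refine ⟨_, h1, h2, h3, h4, hτ1, rfl, h5.trans (ENNReal.ofReal_le_ofReal ?_), ?_⟩
  · rw [hD, show (|D| + 1) / min 1 V * s = s / min 1 V * (|D| + 1) by ring]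
    have h7 : s / V ^ ((1 : ℝ) / (d : ℝ)) ≤ s / min 1 V :=
      div_le_div_of_nonneg_left hs.le hm hVd
    have h8 : D ≤ |D| + 1 := (le_abs_self D).trans (by linarith)
    exact (mul_le_mul_of_nonneg_left h8 hτ.le).trans
      (mul_le_mul_of_nonneg_right h7 (by positivity))
  · rw [hΩV, Transport.div_rpow_inv_pow hV hd] at h6
    exact Transport.rnDeriv_le_of_le_smul h6
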